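/- Let $p$ be a prime, $q=p^s$ with $s>1$ an integer, let $0<i<s$ be an integer and $m=\gcd(i,s)$, and suppose $p^m\ge 3$. Let $h=\frac{q-p^i}{2}$ (for any $p$) or $h=\frac{p^i-1}{2}$ (for $p$ odd). Let $\beta\in\mathbb{F}_{q^2}$ be a primitive $(q+1)$-th root of unity, and let $\mathcal{C}=\mathcal{C}_{(q,q+1,3,h)}\subseteq\mathbb{F}_q^{q+1}$ be the BCH code of length $q+1$ and designed distance $3$, i.e. the set of words $(c_0,\dots,c_q)$ such that $c_0+c_1x+\cdots+c_qx^q$ lies in the ideal of $\mathbb{F}_q[x]/(x^{q+1}-1)$ generated by the least common multiple of the minimal polynomials over $\mathbb{F}_q$ of $\beta^h$ and $\beta^{h+1}$. Let $\mathcal{C}^\perp$ be its dual with respect to the standard inner product. For a linear code $\mathcal{D}\subseteq\mathbb{F}_q^n$, let $\mathcal{B}_k(\mathcal{D})$ be the multiset of the supports of the codewords of weight $k$ in $\mathcal{D}$, with all multiplicities divided by $q-1$. The codewords of weight $k$ in $\mathcal{D}$ are said to support a simple $t$-$(n,k,\lambda)$ design if $1\le t<k<n$, the multiset $\mathcal{B}_k(\mathcal{D})$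 of $k$-subsets of the $n$ coordinate positions has no repeated elements, and every set of $t$ coordinate positions is contained in exactly $\lambda$ of its elements. Then: 1. $\mathcal{C}$ has minimum distance $4$, and its codewords of weight $4$ support a simple $3$-$(q+1,4,p^m-2)$ design. 2. $\mathcal{C}^\perp$ has minimum distance $q-p^m$, and its codewords of weight $q-p^m$ support a simple $3$-$(q+1,q-p^m,\lambda)$ design with $$\lambda=\frac{(q-p^m)(q-p^m-1)(q-p^m-2)}{(p^{2m}-1)p^{m}}.$$ 3. The weight enumerator $\sum_{w=0}^{q+1}A_w^\perp z^w$ of $\mathcal{C}^\perp$, where $A_w^\perp$ is the number of codewords of weight $w$ in $\mathcal{C}^\perp$, is $$1+\frac{(q-1)^2q(q+1)}{(p^{2m}-1)p^{m}}z^{q-p^m}+\frac{(q^2-1)q\bigl((q+1)(p^m-1)-(q-1)\bigr)}{2(p^m-1)}z^{q-1}+\frac{(q^2-1)(q^2-q+p^m)}{p^m}z^q+\frac{p^m(q-1)^2q(q+1)}{2(p^m+1)}z^{q+1}.$$ -/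

import Mathlib

/-! Linear codes of length `n` over a field `F`, as subspaces of `Fin n → F`. -/

namespace CodeDesign

open Polynomial

section Codes

variable {F : Type*} [Field F] {n : ℕ}

open Classical in
/-- The support of a word: the set of its nonzero coordinate positions. -/
noncomputable def supp (c : Fin n → F) : Finset (Fin n) :=
  Finset.univ.filter fun i => c i ≠ 0

/-- The Hamming weight of a word. -/
noncomputable def wt (c : Fin n → F) : ℕ := (supp c).card

/-- The dual code with respect to the standard inner product. -/
def dual (C : Submodule F (Fin n → F)) : Submodule F (Fin n → F) where
  carrier := {v | ∀ c ∈ C, ∑ j, c j * v j = 0}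
  zero_mem' := by intro c _; simp
  add_mem' := by
    intro a b ha hb c hc
    simp only [Pi.add_apply, mul_add, Finset.sum_add_distrib]
    rw [ha c hc, hb c hc, add_zero]
  smul_mem' := by
    intro r a ha c hc
    have h : ∑ j, c j * (r • a) j = r * ∑ j, c j * a j := by
      rw [Finset.mul_sum]
      exact Finset.sum_congr rfl fun j _ => by simp only [Pi.smul_apply, smul_eq_mul]; ring
    rw [h, ha c hc, mul_zero]

/-- `d` is the minimum distance of `C`: the least weight of a nonzero codeword. -/
def IsMinDist (C : Submodule F (Fin n → F)) (d : ℕ) : Prop :=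
  IsLeast {w : ℕ | ∃ c ∈ C, c ≠ 0 ∧ wt c = w} d

/-- The number `A_w` of codewords of weight `w`. -/
noncomputable def weightCount (C : Submodule F (Fin n → F)) (w : ℕ) : ℕ :=
  {c : Fin n → F | c ∈ C ∧ wt c = w}.ncard

/-- The weight enumerator `∑ A_w z ^ w`, with coefficients viewed as rational numbers. -/
noncomputable def weightEnumerator (C : Submodule F (Fin n → F)) : ℚ[X] :=
  ∑ w ∈ Finset.range (n + 1), Polynomial.C (weightCount C w : ℚ) * X ^ w

open Classical in
/-- The multiset of the supports of all codewords of weight `w`, each codeword contributing its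
support once. -/
noncomputable def supportMultiset [Fintype F] (C : Submodule F (Fin n → F)) (w : ℕ) :
    Multiset (Finset (Fin n)) :=
  (Finset.univ.filter fun c : Fin n → F => c ∈ C ∧ wt c = w).val.map supp

/-- The word with coordinates `c_0, …, c_{n-1}` as the polynomial `c_0 + c_1 x + ⋯`. -/
noncomputable def wordPoly : (Fin n → F) →ₗ[F] F[X] :=
  ∑ j : Fin n, (Polynomial.monomial (j : ℕ)).comp (LinearMap.proj j)

/-- The code of length `n` generated by `g`: the words whose class in `F[x] / (x ^ n - 1)` lies in
the ideal generated by the class of `g`. -/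
noncomputable def cyclicCode (F : Type*) [Field F] (n : ℕ) (g : F[X]) :
    Submodule F (Fin n → F) :=
  ((Ideal.span {Ideal.Quotient.mk (Ideal.span {(X ^ n - 1 : F[X])}) g}).restrictScalars F).comap
    ((Ideal.Quotient.mkₐ F (Ideal.span {(X ^ n - 1 : F[X])})).toLinearMap ∘ₗ wordPoly)

open Classical in
/-- The generator polynomial of a BCH code: the (monic) least common multiple over `F` of the
minimal polynomials over `F` of `β ^ h, β ^ (h + 1), …, β ^ (h + δ - 2)`. -/
noncomputable def bchGenerator (F : Type*) [Field F] {L : Type*} [Field L] [Algebra F L]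
    (β : L) (δ h : ℕ) : F[X] :=
  (Finset.range (δ - 1)).lcm fun j => minpoly F (β ^ (h + j))

/-- The BCH code of length `n` over `F` with designed distance `δ` and offset `h`, built from `β`
(to be a primitive `n`-th root of unity in an extension field of `F`). -/
noncomputable def bchCode (F : Type*) [Field F] {L : Type*} [Field L] [Algebra F L]
    (β : L) (n δ h : ℕ) : Submodule F (Fin n → F) :=
  cyclicCode F n (bchGenerator F β δ h)

end Codes

section Designs

open Classical in
/-- The multiset `B` of blocks on the point set `P` is a `t`-`(v, k, lam)` design. -/
structure IsDesign {P : Type*} [Fintype P] (t v k lam : ℕ) (B : Multiset (Finset P)) : Prop where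
  one_le : 1 ≤ t
  le_block : t ≤ k
  card_points : Fintype.card P = v
  card_block : ∀ b ∈ B, b.card = k
  balanced : ∀ T : Finset P, T.card = t → Multiset.card (B.filter fun b => T ⊆ b) = lam

/-- A simple design with `t < k < v`: no block is repeated. -/
structure IsSimpleDesign {P : Type*} [Fintype P] (t v k lam : ℕ) (B : Multiset (Finset P)) : Prop
    extends IsDesign t v k lam B where
  nodup : B.Nodup
  lt_block : t < k
  block_lt : k < v

/-- The codewords of weight `k` of `C` support a simple `t`-`(v, k, lam)` design. The block multiset
`B` is the multiset of supports with all multiplicities divided by `q - 1`, where `q = |F|`; that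
is, `(q - 1) • B` is the multiset of supports. -/
def SupportsSimpleDesign {F : Type*} [Field F] [Fintype F] {n : ℕ}
    (C : Submodule F (Fin n → F)) (t v k lam : ℕ) : Prop :=
  ∃ B : Multiset (Finset (Fin n)),
    (Fintype.card F - 1) • B = supportMultiset C k ∧ IsSimpleDesign t v k lam B

end Designs

end CodeDesign

open Polynomial CodeDesign

/-! Write `Q = p ^ i`, `r = p ^ m`, and let `D` be the code of words with coordinates `Tr (a * u ^ h
+ b * u ^ (h + 1))`, where `u` runs over the `(q + 1)`-th roots of unity. Nondegeneracy of the trace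
form makes the BCH code the dual of `D` (`dual_range_traceMap`), so its own dual is `D`.

Since `u ^ q = u⁻¹`, the choice of `h` lets a power of `u` turn each coordinate into a polynomial of
degree at most one in `u` and in `u ^ Q` (`exists_biaffine`). If such a nonzero polynomial vanishes
at three of the points, it cuts out the graph of the unique projectivity with these three values
(`biaffine_eq_zero_iff`). Its zeros are then the points whose cross-ratio with the three is fixed by
`x ↦ x ^ Q`. Cross-ratio identifies the roots of unity with the projective line over the field of
`q` elements, so the zeros form a subline of `r + 1` points that depends only on the three points
(`card_subline`).

Hence `D` has dimension four and its zero sets of size at least three form a `3`-`(q + 1, r + 1, 1)`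
design. This is `IsSteinerCode`, and the rest follows from it alone. Any three coordinates are
independent on `D`, so the dual has no nonzero word of weight at most `3`, and its supports of size
`4` are the `4`-subsets of blocks. The minimum weight supports of `D` are the complements of blocks,
so `lam` counts the blocks that miss three points. Finally, a nonzero word of `D` has `0`, `1`, `2`
or `r + 1` zeros, and four binomial moments determine the four frequencies. -/

namespace CodeDesign

/-! ### Linear codes: supports, restrictions, duality, weight enumerators -/

section Codes

variable {F : Type*} [Field F] {n : ℕ}

lemma mem_supp {c : Fin n → F} {j : Fin n} : j ∈ supp c ↔ c j ≠ 0 := by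
  simp [supp]

lemma notMem_supp {c : Fin n → F} {j : Fin n} : j ∉ supp c ↔ c j = 0 := by
  simp [supp]

lemma supp_smul {a : F} (ha : a ≠ 0) (c : Fin n → F) : supp (a • c) = supp c := by
  ext j; simp [mem_supp, ha]

lemma wt_pos_iff {c : Fin n → F} : 0 < wt c ↔ c ≠ 0 := by
  rw [wt, Finset.card_pos, Function.ne_iff]
  exact exists_congr fun j => mem_supp

/-- The set of zero coordinate positions of a word. -/
noncomputable def zeros (c : Fin n → F) : Finset (Fin n) := (supp c)ᶜ

lemma mem_zeros {c : Fin n → F} {j : Fin n} : j ∈ zeros c ↔ c j = 0 := by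
  simp [zeros, notMem_supp]

lemma wt_add_card_zeros (c : Fin n → F) : wt c + (zeros c).card = n := by
  rw [wt, zeros, Finset.card_add_card_compl, Fintype.card_fin]

/-- The restriction of words to a set of positions. -/
noncomputable def restrict (F : Type*) [Field F] (T : Finset (Fin n)) :
    (Fin n → F) →ₗ[F] (T → F) :=
  LinearMap.funLeft F F Subtype.val

lemma restrict_apply (T : Finset (Fin n)) (c : Fin n → F) (j : T) : restrict F T c j = c j := rfl

lemma restrict_eq_zero_iff {T : Finset (Fin n)} {c : Fin n → F} :
    restrict F T c = 0 ↔ T ⊆ zeros c := by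
  simp [funext_iff, restrict_apply, Finset.subset_iff, mem_zeros]

lemma mem_dual {C : Submodule F (Fin n → F)} {v : Fin n → F} :
    v ∈ dual C ↔ ∀ c ∈ C, ∑ j, c j * v j = 0 := Iff.rfl

/-- If the restriction of a code to a set of positions is not surjective, then some nonzero word of
the dual code is supported on this set. -/
lemma exists_mem_dual_of_not_surjective {D : Submodule F (Fin n → F)} {T : Finset (Fin n)}
    (hT : ¬ Function.Surjective ((restrict F T).domRestrict D)) :
    ∃ c ∈ dual D, c ≠ 0 ∧ supp c ⊆ T := by
  classical
  rw [← LinearMap.range_eq_top] at hT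
  obtain ⟨f, hf0, hf⟩ := Submodule.exists_le_ker_of_lt_top _ (lt_top_iff_ne_top.2 hT)
  have hfs (x : T → F) : f x = ∑ j : T, f (Pi.single j 1) * x j := by
    conv_lhs => rw [pi_eq_sum_univ' x]
    simp [map_sum, mul_comm]
  -- The coefficients of a functional that kills the restricted code, extended by zero, form the
  -- dual word.
  let c : Fin n → F := fun j => if hj : j ∈ T then f (Pi.single ⟨j, hj⟩ 1) else 0
  have hsum (d : Fin n → F) : ∑ j, d j * c j = f (restrict F T d) := by
    rw [hfs, ← Finset.sum_subset (Finset.subset_univ T) (fun j _ hj => by simp [c, hj]),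
      ← Finset.sum_coe_sort T]
    exact Finset.sum_congr rfl fun j _ => by simp [c, restrict_apply, mul_comm]
  refine ⟨c, fun d hd => ?_, fun hc => hf0 ?_, fun j hj => ?_⟩
  · rw [hsum]
    exact hf ⟨⟨d, hd⟩, rfl⟩
  · ext x
    simp only [LinearMap.comp_apply, LinearMap.zero_apply, LinearMap.coe_single]
    have h1 := congrFun hc x
    simp only [c, Pi.zero_apply, x.2, dif_pos] at h1
    exact h1
  · by_contra h
    exact mem_supp.1 hj (by simp [c, h])

/-- A word of the dual code that is supported on a set of positions on which the code restricts
surjectively is zero. -/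
lemma eq_zero_of_mem_dual_of_surjective {D : Submodule F (Fin n → F)} {T : Finset (Fin n)}
    (hT : Function.Surjective ((restrict F T).domRestrict D)) {c : Fin n → F} (hc : c ∈ dual D)
    (hcT : supp c ⊆ T) : c = 0 := by
  classical
  ext j
  by_cases hj : j ∈ T
  -- A word of the code that is `1` at `j` and `0` elsewhere on `T` pairs with `c` to give exactly
  -- `c j`.
  · obtain ⟨⟨d, hd⟩, hdj⟩ := hT (Pi.single ⟨j, hj⟩ 1)
    have hdj' (k : Fin n) (hk : k ∈ T) : d k = if k = j then 1 else 0 := by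
      have := congrFun hdj ⟨k, hk⟩
      simpa [restrict_apply, Pi.single_apply, LinearMap.domRestrict_apply] using this
    have h0 := hc d hd
    rw [Finset.sum_eq_single j] at h0
    · simpa [hdj' j hj] using h0
    · intro k _ hkj
      by_cases hk : k ∈ T
      · simp [hdj' k hk, hkj]
      · simp [notMem_supp.1 fun h => hk (hcT h)]
    · simp
  · exact notMem_supp.1 fun h => hj (hcT h)

open Classical in
/-- The supports of the words of weight `k`, each taken once. -/
noncomputable def blocks [Fintype F] (C : Submodule F (Fin n → F)) (k : ℕ) :
    Finset (Finset (Fin n)) :=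
  (Finset.univ.filter fun c : Fin n → F => c ∈ C ∧ wt c = k).image supp

lemma mem_blocks [Fintype F] {C : Submodule F (Fin n → F)} {k : ℕ} {S : Finset (Fin n)} :
    S ∈ blocks C k ↔ ∃ c ∈ C, wt c = k ∧ supp c = S := by
  simp [blocks, and_assoc]

lemma card_of_mem_blocks [Fintype F] {C : Submodule F (Fin n → F)} {k : ℕ} {S : Finset (Fin n)}
    (hS : S ∈ blocks C k) : S.card = k := by
  obtain ⟨c, -, hc, rfl⟩ := mem_blocks.1 hS
  exact hc

/-- If words of weight `k` with equal supports are proportional, then each support occurs `q - 1`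
times. -/
lemma nsmul_blocks_eq_supportMultiset [Fintype F] {C : Submodule F (Fin n → F)} {k : ℕ}
    (hk : 0 < k)
    (h : ∀ c ∈ C, ∀ c' ∈ C, wt c = k → supp c = supp c' → ∃ a : F, c' = a • c) :
    (Fintype.card F - 1) • (blocks C k).val = supportMultiset C k := by
  classical
  ext S
  rw [Multiset.count_nsmul, supportMultiset, Multiset.count_map]
  by_cases hS : S ∈ blocks C k
  · rw [Multiset.count_eq_one_of_mem (blocks C k).nodup hS, mul_one]
    obtain ⟨c, hc, hck, rfl⟩ := mem_blocks.1 hS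
    have hc0 : c ≠ 0 := wt_pos_iff.1 (hck ▸ hk)
    have himg : ((Finset.univ.filter fun c : Fin n → F => c ∈ C ∧ wt c = k).filter
        fun c' => supp c = supp c') = (Finset.univ.erase (0 : F)).image fun a => a • c := by
      ext c'
      simp only [Finset.mem_filter, Finset.mem_univ, true_and, Finset.mem_image, Finset.mem_erase,
        and_true]
      constructor
      · rintro ⟨⟨hc', hk'⟩, hs⟩
        obtain ⟨a, rfl⟩ := h c hc c' hc' hck hs
        refine ⟨a, ?_, rfl⟩
        rintro rfl
        rw [zero_smul] at hk'
        exact wt_pos_iff.1 (hk'.symm ▸ hk : 0 < wt (0 : Fin n → F)) rfl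
      · rintro ⟨a, ha, rfl⟩
        exact ⟨⟨C.smul_mem a hc, by rw [wt, supp_smul ha, ← hck, wt]⟩, (supp_smul ha c).symm⟩
    have hcard := congrArg Finset.card himg
    rw [Finset.card_image_of_injective _ (smul_left_injective F hc0),
      Finset.card_erase_of_mem (Finset.mem_univ _), Finset.card_univ] at hcard
    rw [← hcard]
    rfl
  · rw [Multiset.count_eq_zero_of_notMem hS, mul_zero, eq_comm, Multiset.card_eq_zero,
      Multiset.filter_eq_nil]
    rintro c hc rfl
    have hc' : c ∈ Finset.univ.filter fun c : Fin n → F => c ∈ C ∧ wt c = k := hc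
    rw [Finset.mem_filter] at hc'
    exact hS (mem_blocks.2 ⟨c, hc'.2.1, hc'.2.2, rfl⟩)

/-- The double dual of a code is the code. -/
lemma dual_dual (C : Submodule F (Fin n → F)) : dual (dual C) = C := by
  refine le_antisymm (fun v hv => ?_) fun v hv c hc => ?_
  · by_contra hvC
    -- A functional that vanishes on `C` but not at `v` is the pairing with a word of the dual, and
    -- `v` is orthogonal to that word.
    obtain ⟨f, hfv, hf⟩ := Submodule.exists_dual_map_eq_bot_of_notMem hvC inferInstance
    classical
    have hfs (x : Fin n → F) : f x = ∑ j, x j * f (Pi.single j 1) := by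
      conv_lhs => rw [pi_eq_sum_univ' x]
      simp [map_sum]
    refine hfv ?_
    rw [hfs, ← hv (fun j => f (Pi.single j 1)) fun c hc => ?_]
    · exact Finset.sum_congr rfl fun j _ => mul_comm _ _
    · rw [← hfs]
      have : f c ∈ C.map f := Submodule.mem_map_of_mem hc
      rwa [hf] at this
  · rw [← hc v hv]
    exact Finset.sum_congr rfl fun j _ => mul_comm _ _

open Classical in
lemma weightEnumerator_eq_sum [Fintype F] (C : Submodule F (Fin n → F)) :
    weightEnumerator C = ∑ c : Fin n → F with c ∈ C, (X : ℚ[X]) ^ wt c := by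
  rw [weightEnumerator, ← Finset.sum_fiberwise_of_maps_to (t := Finset.range (n + 1)) (g := wt)]
  · refine Finset.sum_congr rfl fun w _ => ?_
    rw [Finset.sum_congr rfl (g := fun _ => (X : ℚ[X]) ^ w)
      fun c hc => by rw [(Finset.mem_filter.1 hc).2], Finset.sum_const, nsmul_eq_mul, weightCount,
      Set.ncard_eq_toFinset_card']
    simp [Finset.filter_filter]
  · intro c _
    have := wt_add_card_zeros c
    rw [Finset.mem_range]; omega

end Codes

/-! ### Counting blocks in Steiner systems -/

section SteinerSystems

variable {P : Type*} [DecidableEq P] {B : Finset (Finset P)} {k : ℕ}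

/-- Double counting of the flags `x ∈ Z` with `x ∉ S ⊆ Z`. -/
lemma sum_card_blocks_insert [Fintype P] (hB : ∀ Z ∈ B, Z.card = k) (S : Finset P) :
    ∑ x ∈ Sᶜ, (B.filter fun Z => insert x S ⊆ Z).card =
      (k - S.card) * (B.filter fun Z => S ⊆ Z).card := by
  have h := Finset.sum_card_bipartiteAbove_eq_sum_card_bipartiteBelow (s := Sᶜ)
    (t := B.filter fun Z => S ⊆ Z) (fun x Z => x ∈ Z)
  have h1 (x : P) : (B.filter fun Z => S ⊆ Z).bipartiteAbove (fun x Z => x ∈ Z) x =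
      B.filter fun Z => insert x S ⊆ Z := by
    ext Z
    simp only [Finset.bipartiteAbove, Finset.mem_filter, Finset.insert_subset_iff]
    tauto
  have h2 (Z : Finset P) (hZ : Z ∈ B.filter fun Z => S ⊆ Z) :
      (Sᶜ.bipartiteBelow (fun x Z => x ∈ Z) Z).card = k - S.card := by
    rw [Finset.mem_filter] at hZ
    rw [← hB Z hZ.1, ← Finset.card_sdiff_of_subset hZ.2]
    congr 1
    ext x
    simp [Finset.bipartiteBelow, and_comm]
  simp only [h1] at h
  rw [h, Finset.sum_congr rfl h2, Finset.sum_const, smul_eq_mul, mul_comm]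

/-- Inclusion-exclusion for the blocks that avoid three points. -/
lemma card_blocks_disjoint {a b c : P} :
    ((B.filter fun Z => Disjoint {a, b, c} Z).card : ℚ) =
      (B.filter fun Z => ∅ ⊆ Z).card
      - ((B.filter fun Z => {a} ⊆ Z).card + (B.filter fun Z => {b} ⊆ Z).card +
        (B.filter fun Z => {c} ⊆ Z).card)
      + ((B.filter fun Z => {a, b} ⊆ Z).card + (B.filter fun Z => {a, c} ⊆ Z).card +
        (B.filter fun Z => {b, c} ⊆ Z).card)
      - (B.filter fun Z => {a, b, c} ⊆ Z).card := by
  simp only [Finset.card_filter, Nat.cast_sum, ← Finset.sum_add_distrib, ← Finset.sum_sub_distrib]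
  refine Finset.sum_congr rfl fun Z _ => ?_
  by_cases ha : a ∈ Z <;> by_cases hb : b ∈ Z <;> by_cases hc : c ∈ Z <;>
    simp [Finset.insert_subset_iff, ha, hb, hc]; norm_num

/-- In a `3`-`(q + 1, r + 1, 1)` design, the number of blocks that avoid three given points. -/
lemma card_blocks_disjoint_of_steiner [Fintype P] {q r : ℕ} (hr : 2 ≤ r) (hP : Fintype.card P = q + 1)
    (hB : ∀ Z ∈ B, Z.card = r + 1)
    (h3 : ∀ T : Finset P, T.card = 3 → (B.filter fun Z => T ⊆ Z).card = 1)
    {T : Finset P} (hT : T.card = 3) :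
    ((B.filter fun Z => Disjoint T Z).card : ℚ) =
      ((q : ℚ) - r) * (q - r - 1) * (q - r - 2) / (((r : ℚ) ^ 2 - 1) * r) := by
  have hr' : (2 : ℚ) ≤ r := by exact_mod_cast hr
  have hq : 2 ≤ q := by
    have := hT ▸ Finset.card_le_univ T
    omega
  have hr0 : (r : ℚ) ≠ 0 := by linarith
  have hr1 : (r : ℚ) - 1 ≠ 0 := by linarith
  have hr2 : (r : ℚ) + 1 ≠ 0 := by linarith
  -- Descent from triples to pairs, points and the empty set by double counting: a pair extends by
  -- `q - 1` points, and each block through it contains `r - 1` of them.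
  have h2 (S : Finset P) (hS : S.card = 2) :
      ((B.filter fun Z => S ⊆ Z).card : ℚ) = (q - 1) / (r - 1) := by
    have h := sum_card_blocks_insert hB S
    rw [Finset.sum_congr rfl (g := fun _ => 1) fun x hx => h3 _ (by
      rw [Finset.card_insert_of_notMem (Finset.mem_compl.1 hx), hS]), Finset.sum_const,
      Finset.card_compl, hP, hS, smul_eq_mul, mul_one] at h
    have h' : (((q + 1 - 2 : ℕ)) : ℚ) = ((r + 1 - 2 : ℕ) : ℚ) *
        (B.filter fun Z => S ⊆ Z).card := by exact_mod_cast h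
    rw [Nat.cast_sub (by omega), Nat.cast_sub (by omega)] at h'
    push_cast at h'
    rw [eq_div_iff hr1]; linarith
  have h1 (S : Finset P) (hS : S.card = 1) :
      ((B.filter fun Z => S ⊆ Z).card : ℚ) = q * (q - 1) / (r * (r - 1)) := by
    have h : ((∑ x ∈ Sᶜ, (B.filter fun Z => insert x S ⊆ Z).card : ℕ) : ℚ) = _ :=
      congrArg Nat.cast (sum_card_blocks_insert hB S)
    rw [Nat.cast_sum, Finset.sum_congr rfl fun x hx => h2 _ (by
      rw [Finset.card_insert_of_notMem (Finset.mem_compl.1 hx), hS]), Finset.sum_const,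
      Finset.card_compl, hP, hS, nsmul_eq_mul] at h
    push_cast [Nat.add_sub_cancel] at h
    field_simp at h ⊢
    linarith
  have h0 : ((B.filter fun Z => ∅ ⊆ Z).card : ℚ) =
      (q + 1) * q * (q - 1) / ((r + 1) * r * (r - 1)) := by
    have h : ((∑ x ∈ (∅ : Finset P)ᶜ, (B.filter fun Z => insert x ∅ ⊆ Z).card : ℕ) : ℚ) = _ :=
      congrArg Nat.cast (sum_card_blocks_insert hB ∅)
    rw [Nat.cast_sum, Finset.sum_congr rfl fun x _ => h1 _ (by simp), Finset.sum_const,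
      Finset.card_compl, hP, Finset.card_empty, nsmul_eq_mul] at h
    push_cast [Nat.sub_zero] at h
    field_simp at h ⊢
    linarith
  obtain ⟨a, b, c, hab, hac, hbc, rfl⟩ := Finset.card_eq_three.1 hT
  rw [card_blocks_disjoint, h0, h1 _ (by simp), h1 _ (by simp), h1 _ (by simp),
    h2 _ (Finset.card_pair hab), h2 _ (Finset.card_pair hac), h2 _ (Finset.card_pair hbc), h3 _ hT]
  have : (r : ℚ) ^ 2 - 1 = (r + 1) * (r - 1) := by ring
  rw [this]
  field_simp
  push_cast
  ring

end SteinerSystems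

/-! ### Designs from codes whose zero sets form a Steiner system -/

section SteinerCodes

variable {F : Type*} [Field F] {n r : ℕ} {D : Submodule F (Fin n → F)}

/-- A code of dimension four in which the zero set of a nonzero word with at least three zeros has
size `r + 1` and is determined by any three of its elements. -/
structure IsSteinerCode (D : Submodule F (Fin n → F)) (r : ℕ) : Prop where
  finrank_eq : Module.finrank F D = 4
  three_le : 3 ≤ r
  lt : r + 1 < n
  exists_zeros : ∀ T : Finset (Fin n), T.card = 3 → ∃ Z : Finset (Fin n), Z.card = r + 1 ∧
    ∀ d ∈ D, d ≠ 0 → T ⊆ zeros d → zeros d = Z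

namespace IsSteinerCode

lemma zeros_eq (hD : IsSteinerCode D r) {T : Finset (Fin n)} (hT : T.card = 3) {d d' : Fin n → F}
    (hd : d ∈ D) (hd0 : d ≠ 0) (hdT : T ⊆ zeros d) (hd' : d' ∈ D) (hd0' : d' ≠ 0)
    (hdT' : T ⊆ zeros d') : zeros d = zeros d' := by
  obtain ⟨Z, -, hZ⟩ := hD.exists_zeros T hT
  rw [hZ d hd hd0 hdT, hZ d' hd' hd0' hdT']

lemma card_zeros (hD : IsSteinerCode D r) {d : Fin n → F} (hd : d ∈ D) (hd0 : d ≠ 0)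
    (h : 3 ≤ (zeros d).card) : (zeros d).card = r + 1 := by
  obtain ⟨T, hTd, hT⟩ := Finset.exists_subset_card_eq h
  obtain ⟨Z, hZ, hZd⟩ := hD.exists_zeros T hT
  rw [hZd d hd hd0 hTd, hZ]

lemma card_zeros_le (hD : IsSteinerCode D r) {d : Fin n → F} (hd : d ∈ D) (hd0 : d ≠ 0) :
    (zeros d).card ≤ r + 1 := by
  have := hD.three_le
  by_cases h : 3 ≤ (zeros d).card
  · exact (hD.card_zeros hd hd0 h).le
  · omega

/-- Subtracting the multiple of `d` that agrees with `d'` at a position `j` with `d j ≠ 0` leaves a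
word vanishing on `T` and at `j`. Were it nonzero, its zero set would be that of `d`, which misses
`j`. -/
lemma exists_eq_smul (hD : IsSteinerCode D r) {T : Finset (Fin n)} (hT : T.card = 3)
    {d d' : Fin n → F} (hd : d ∈ D) (hd0 : d ≠ 0) (hdT : T ⊆ zeros d) (hd' : d' ∈ D)
    (hdT' : T ⊆ zeros d') : ∃ a : F, d' = a • d := by
  obtain ⟨j, hj⟩ := Function.ne_iff.1 hd0
  rw [Pi.zero_apply] at hj
  refine ⟨d' j / d j, sub_eq_zero.1 ?_⟩
  by_contra h
  have hmem : d' - (d' j / d j) • d ∈ D := D.sub_mem hd' (D.smul_mem _ hd)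
  have hz := hD.zeros_eq hT hmem h (fun k hk => by
    simp [mem_zeros, mem_zeros.1 (hdT hk), mem_zeros.1 (hdT' hk)]) hd hd0 hdT
  have hj' : j ∈ zeros (d' - (d' j / d j) • d) := mem_zeros.2 (by simp [hj])
  exact hj (mem_zeros.1 (hz ▸ hj'))

/-- Words vanishing on `T` are proportional, so the kernel has dimension at most `1` and the image
at least `4 - 1 = 3`. -/
lemma surjective_of_card_eq_three (hD : IsSteinerCode D r) {T : Finset (Fin n)} (hT : T.card = 3) :
    Function.Surjective ((restrict F T).domRestrict D) := by
  set f := (restrict F T).domRestrict D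
  have hker : Module.finrank F (LinearMap.ker f) ≤ 1 := by
    by_cases h : LinearMap.ker f = ⊥
    · rw [h, finrank_bot]; exact zero_le_one
    · obtain ⟨d, hd, hd0⟩ := (Submodule.ne_bot_iff _).1 h
      refine finrank_le_one ⟨d, hd⟩ fun ⟨w, hw⟩ => ?_
      obtain ⟨a, ha⟩ := hD.exists_eq_smul hT d.2 (by simpa using hd0)
        (restrict_eq_zero_iff.1 hd) w.2 (restrict_eq_zero_iff.1 hw)
      exact ⟨a, by ext1; ext1; exact ha.symm⟩
  have hsum := LinearMap.finrank_range_add_finrank_ker f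
  rw [hD.finrank_eq] at hsum
  rw [← LinearMap.range_eq_top]
  refine Submodule.eq_top_of_finrank_eq (le_antisymm (Submodule.finrank_le _) ?_)
  rw [Module.finrank_fintype_fun_eq_card, Fintype.card_coe, hT]
  omega

lemma surjective_of_card_le_three (hD : IsSteinerCode D r) {T : Finset (Fin n)}
    (hT : T.card ≤ 3) : Function.Surjective ((restrict F T).domRestrict D) := by
  classical
  have hn : 3 ≤ Fintype.card (Fin n) := by
    have := hD.three_le; have := hD.lt
    rw [Fintype.card_fin]; omega
  obtain ⟨T', hTT', hT'⟩ := Finset.exists_superset_card_eq hT hn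
  intro x
  obtain ⟨d, hd⟩ := hD.surjective_of_card_eq_three hT'
    fun j => if hj : (j : Fin n) ∈ T then x ⟨j, hj⟩ else 0
  refine ⟨d, funext fun j => ?_⟩
  have := congrFun hd ⟨j, hTT' j.2⟩
  simpa [restrict_apply, LinearMap.domRestrict_apply] using this

lemma not_surjective_iff (hD : IsSteinerCode D r) {S : Finset (Fin n)} (hS : S.card = 4) :
    ¬ Function.Surjective ((restrict F S).domRestrict D) ↔ ∃ d ∈ D, d ≠ 0 ∧ S ⊆ zeros d := by
  rw [← LinearMap.injective_iff_surjective_of_finrank_eq_finrank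
    (by rw [hD.finrank_eq, Module.finrank_fintype_fun_eq_card, Fintype.card_coe, hS]),
    ← LinearMap.ker_eq_bot, ← ne_eq, Submodule.ne_bot_iff]
  constructor
  · rintro ⟨d, hd, hd0⟩
    exact ⟨d, d.2, by simpa using hd0, restrict_eq_zero_iff.1 hd⟩
  · rintro ⟨d, hd, hd0, hdS⟩
    exact ⟨⟨d, hd⟩, restrict_eq_zero_iff.2 hdS, by simpa using hd0⟩

lemma exists_subset_zeros (hD : IsSteinerCode D r) {T : Finset (Fin n)} (hT : T.card = 3) :
    ∃ d ∈ D, d ≠ 0 ∧ T ⊆ zeros d := by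
  have h : LinearMap.ker ((restrict F T).domRestrict D) ≠ ⊥ :=
    LinearMap.ker_ne_bot_of_finrank_lt (by
      rw [hD.finrank_eq, Module.finrank_fintype_fun_eq_card, Fintype.card_coe, hT]; norm_num)
  obtain ⟨d, hd, hd0⟩ := (Submodule.ne_bot_iff _).1 h
  exact ⟨d, d.2, by simpa using hd0, restrict_eq_zero_iff.1 hd⟩

lemma exists_card_eq_three (hD : IsSteinerCode D r) : ∃ T : Finset (Fin n), T.card = 3 := by
  have := hD.three_le
  have := hD.lt
  obtain ⟨T, -, hT⟩ := Finset.exists_subset_card_eq (s := (Finset.univ : Finset (Fin n))) (n := 3)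
    (by rw [Finset.card_univ, Fintype.card_fin]; omega)
  exact ⟨T, hT⟩

/-! The dual code. -/

lemma eq_zero_of_mem_dual (hD : IsSteinerCode D r) {c : Fin n → F} (hc : c ∈ dual D)
    (hw : wt c ≤ 3) : c = 0 :=
  eq_zero_of_mem_dual_of_surjective (hD.surjective_of_card_le_three hw) hc subset_rfl

/-- The code has dimension `4`, so on four positions it restricts bijectively or has a nonzero word
vanishing there. Only the latter allows a dual word supported in `S`, which fills `S` because its
weight is at least `4`. -/
lemma mem_blocks_dual_iff [Fintype F] (hD : IsSteinerCode D r) {S : Finset (Fin n)} :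
    S ∈ blocks (dual D) 4 ↔ S.card = 4 ∧ ∃ d ∈ D, d ≠ 0 ∧ S ⊆ zeros d := by
  rw [mem_blocks]
  constructor
  · rintro ⟨c, hc, hw, rfl⟩
    refine ⟨hw, (hD.not_surjective_iff hw).1 fun hs => ?_⟩
    rw [eq_zero_of_mem_dual_of_surjective hs hc subset_rfl] at hw
    simp [wt, supp] at hw
  · rintro ⟨hS, hd⟩
    obtain ⟨c, hc, hc0, hcS⟩ := exists_mem_dual_of_not_surjective ((hD.not_surjective_iff hS).2 hd)
    have h4 : 4 ≤ wt c := by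
      by_contra h
      exact hc0 (hD.eq_zero_of_mem_dual hc (by omega))
    have hcS' : supp c = S := Finset.eq_of_subset_of_card_le hcS (by rw [hS]; exact h4)
    exact ⟨c, hc, by rw [wt, hcS', hS], hcS'⟩

lemma isMinDist_dual [Fintype F] (hD : IsSteinerCode D r) : IsMinDist (dual D) 4 := by
  constructor
  · obtain ⟨T, hT⟩ := hD.exists_card_eq_three
    obtain ⟨d, hd, hd0, hdT⟩ := hD.exists_subset_zeros hT
    have hz := hD.card_zeros hd hd0 (hT ▸ Finset.card_le_card hdT)
    have := hD.three_le
    obtain ⟨S, hS, hS4⟩ := Finset.exists_subset_card_eq (s := zeros d) (n := 4) (by omega)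
    obtain ⟨c, hc, hw, -⟩ := mem_blocks.1 (hD.mem_blocks_dual_iff.2 ⟨hS4, d, hd, hd0, hS⟩)
    exact ⟨c, hc, wt_pos_iff.1 (by omega), hw⟩
  · rintro w ⟨c, hc, hc0, rfl⟩
    by_contra h
    exact hc0 (hD.eq_zero_of_mem_dual hc (by omega))

lemma supportsSimpleDesign_dual [Fintype F] (hD : IsSteinerCode D r) :
    SupportsSimpleDesign (dual D) 3 n 4 (r - 2) := by
  classical
  refine ⟨(blocks (dual D) 4).val, nsmul_blocks_eq_supportMultiset (by norm_num) ?_, ?_⟩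
  · intro c hc c' hc' hw hs
    obtain ⟨j, hj⟩ := Finset.card_pos.1 (show 0 < (supp c).card by rw [← wt, hw]; norm_num)
    have hj0 := mem_supp.1 hj
    refine ⟨c' j / c j, sub_eq_zero.1 (hD.eq_zero_of_mem_dual
      (Submodule.sub_mem _ hc' (Submodule.smul_mem _ _ hc)) ?_)⟩
    -- Cancelling one coordinate leaves weight at most `3`, below the minimum distance of the dual.
    have hsub : supp (c' - (c' j / c j) • c) ⊆ (supp c).erase j := by
      intro k hk
      rw [mem_supp] at hk
      rw [Finset.mem_erase]
      constructor
      · rintro rfl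
        exact hk (by simp [hj0])
      · by_contra hkc
        have h1 := notMem_supp.1 hkc
        have h2 := notMem_supp.1 (hs ▸ hkc)
        exact hk (by simp [h1, h2])
    have := Finset.card_le_card hsub
    rw [Finset.card_erase_of_mem hj, ← wt, ← wt, hw] at this
    exact this
  · have h3 := hD.three_le
    have hn := hD.lt
    refine { one_le := by norm_num, le_block := by norm_num, card_points := Fintype.card_fin n
             card_block := fun b hb => card_of_mem_blocks hb, balanced := fun T hT => ?_
             nodup := (blocks (dual D) 4).nodup, lt_block := by norm_num, block_lt := by omega }
    obtain ⟨d, hd, hd0, hdT⟩ := hD.exists_subset_zeros hT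
    have hz := hD.card_zeros hd hd0 (hT ▸ Finset.card_le_card hdT)
    -- A `4`-subset through `T` of the unique zero set containing `T` is `T` and one of the other `r
    -- + 1 - 3 = r - 2` zeros.
    have himg : (blocks (dual D) 4).filter (fun b => T ⊆ b) =
        (zeros d \ T).image fun x => insert x T := by
      ext S
      rw [Finset.mem_filter, hD.mem_blocks_dual_iff, Finset.mem_image]
      constructor
      · rintro ⟨⟨hS, d', hd', hd0', hdS⟩, hTS⟩
        have hzz := hD.zeros_eq hT hd' hd0' (hTS.trans hdS) hd hd0 hdT
        have h1 : (S \ T).card = 1 := by rw [Finset.card_sdiff_of_subset hTS, hS, hT]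
        obtain ⟨x, hx⟩ := Finset.card_eq_one.1 h1
        have hxS : x ∈ S \ T := hx ▸ Finset.mem_singleton_self x
        rw [Finset.mem_sdiff] at hxS
        refine ⟨x, Finset.mem_sdiff.2 ⟨hzz ▸ hdS hxS.1, hxS.2⟩, ?_⟩
        rw [← Finset.sdiff_union_of_subset hTS, hx, Finset.insert_eq]
      · rintro ⟨x, hx, rfl⟩
        rw [Finset.mem_sdiff] at hx
        exact ⟨⟨by rw [Finset.card_insert_of_notMem hx.2, hT], d, hd, hd0,
          Finset.insert_subset hx.1 hdT⟩, Finset.subset_insert _ _⟩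
    have hcard := congrArg Finset.card himg
    rw [Finset.card_image_of_injOn, Finset.card_sdiff_of_subset hdT, hz, hT] at hcard
    · refine Eq.trans ?_ (hcard.trans (by omega))
      rw [Finset.card_def, Finset.filter_val]
      congr!
    · intro x hx y hy hxy
      have hx' := (Finset.mem_sdiff.1 hx).2
      have : x ∈ insert y T := (show insert x T = insert y T from hxy) ▸
        Finset.mem_insert_self x T
      exact (Finset.mem_insert.1 this).resolve_right hx'

/-! The words of minimum weight of the code. -/

lemma isMinDist (hD : IsSteinerCode D r) : IsMinDist D (n - (r + 1)) := by
  constructor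
  · obtain ⟨T, hT⟩ := hD.exists_card_eq_three
    obtain ⟨d, hd, hd0, hdT⟩ := hD.exists_subset_zeros hT
    have hz := hD.card_zeros hd hd0 (hT ▸ Finset.card_le_card hdT)
    have := wt_add_card_zeros d
    exact ⟨d, hd, hd0, by omega⟩
  · rintro w ⟨d, hd, hd0, rfl⟩
    have := wt_add_card_zeros d
    have := hD.card_zeros_le hd hd0
    omega

lemma wt_eq_iff (hD : IsSteinerCode D r) {d : Fin n → F} :
    wt d = n - (r + 1) ↔ (zeros d).card = r + 1 := by
  have := wt_add_card_zeros d
  have := hD.lt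
  omega

lemma exists_subset_zeros_of_wt (hD : IsSteinerCode D r) {d : Fin n → F}
    (hd : wt d = n - (r + 1)) : ∃ T ⊆ zeros d, T.card = 3 := by
  have := hD.three_le
  exact Finset.exists_subset_card_eq (by rw [hD.wt_eq_iff.1 hd]; omega)

/-- A support contains `T` exactly when the complementary zero set avoids `T`. The condition `2 * r
< q` makes the block size `q - r` exceed `3`. -/
lemma supportsSimpleDesign [Fintype F] (hD : IsSteinerCode D r) {q : ℕ} (hn : n = q + 1)
    (hrq : 2 * r < q) :
    ∃ lam : ℕ,
      (lam : ℚ) = ((q : ℚ) - r) * (q - r - 1) * (q - r - 2) / (((r : ℚ) ^ 2 - 1) * r) ∧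
      SupportsSimpleDesign D 3 n (n - (r + 1)) lam := by
  classical
  have h3 := hD.three_le
  have hlt := hD.lt
  set B := (blocks D (n - (r + 1))).image compl with hB
  have hmem {Z : Finset (Fin n)} : Z ∈ B ↔ ∃ d ∈ D, wt d = n - (r + 1) ∧ zeros d = Z := by
    simp only [hB, Finset.mem_image, mem_blocks, zeros]
    constructor
    · rintro ⟨S, ⟨d, hd, hw, rfl⟩, rfl⟩
      exact ⟨d, hd, hw, rfl⟩
    · rintro ⟨d, hd, hw, rfl⟩
      exact ⟨supp d, ⟨d, hd, hw, rfl⟩, rfl⟩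
  have hBcard : ∀ Z ∈ B, Z.card = r + 1 := by
    intro Z hZ
    obtain ⟨d, -, hw, rfl⟩ := hmem.1 hZ
    exact hD.wt_eq_iff.1 hw
  have hne {d : Fin n → F} (hw : wt d = n - (r + 1)) : d ≠ 0 := wt_pos_iff.1 (by omega)
  have hB1 (T : Finset (Fin n)) (hT : T.card = 3) : (B.filter fun Z => T ⊆ Z).card = 1 := by
    obtain ⟨d, hd, hd0, hdT⟩ := hD.exists_subset_zeros hT
    have hz := hD.card_zeros hd hd0 (hT ▸ Finset.card_le_card hdT)
    refine Finset.card_eq_one.2 ⟨zeros d, ?_⟩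
    ext Z
    rw [Finset.mem_filter, hmem, Finset.mem_singleton]
    constructor
    · rintro ⟨⟨d', hd', hw', rfl⟩, hT'⟩
      exact hD.zeros_eq hT hd' (hne hw') hT' hd hd0 hdT
    · rintro rfl
      exact ⟨⟨d, hd, hD.wt_eq_iff.2 hz, rfl⟩, hdT⟩
  have hcount (T : Finset (Fin n)) (hT : T.card = 3) :=
    card_blocks_disjoint_of_steiner (q := q) (by omega) (by rw [Fintype.card_fin, hn]) hBcard hB1 hT
  obtain ⟨T₀, hT₀⟩ := hD.exists_card_eq_three
  refine ⟨_, hcount T₀ hT₀, (blocks D (n - (r + 1))).val,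
    nsmul_blocks_eq_supportMultiset (by omega) ?_, ?_⟩
  · intro c hc c' hc' hw hs
    obtain ⟨T, hTc, hT⟩ := hD.exists_subset_zeros_of_wt hw
    exact hD.exists_eq_smul hT hc (hne hw) hTc hc' (by rwa [zeros, ← hs])
  · refine { one_le := by norm_num, le_block := by omega, card_points := Fintype.card_fin n
             card_block := fun b hb => card_of_mem_blocks hb, balanced := fun T hT => ?_
             nodup := (blocks D _).nodup, lt_block := by omega, block_lt := by omega }
    -- The closed formula does not involve the triple, so the count at `T₀` serves as `lam` for all
    -- of them.
    have h : (B.filter fun Z => Disjoint T Z).card = (B.filter fun Z => Disjoint T₀ Z).card := by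
      exact_mod_cast (hcount T hT).trans (hcount T₀ hT₀).symm
    rw [← h, hB, Finset.filter_image, Finset.card_image_of_injective _ compl_injective]
    simp only [disjoint_compl_right_iff]
    rw [Finset.card_def, Finset.filter_val]
    congr!

end IsSteinerCode

end SteinerCodes

/-! ### The weight enumerator from binomial moments -/

namespace IsSteinerCode

variable {F : Type*} [Field F] {n r : ℕ} {D : Submodule F (Fin n → F)}

open Classical in
/-- The number of words of the code that vanish on at most three given positions. -/
lemma card_filter_subset_zeros [Fintype F] (hD : IsSteinerCode D r) {T : Finset (Fin n)}
    (hT : T.card ≤ 3) :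
    (Finset.univ.filter fun d : Fin n → F => d ∈ D ∧ T ⊆ zeros d).card =
      Fintype.card F ^ (4 - T.card) := by
  set f := (restrict F T).domRestrict D with hf
  have hsum := LinearMap.finrank_range_add_finrank_ker f
  rw [hD.finrank_eq, LinearMap.range_eq_top.2 (hD.surjective_of_card_le_three hT), finrank_top,
    Module.finrank_fintype_fun_eq_card, Fintype.card_coe] at hsum
  have hker : Module.finrank F (LinearMap.ker f) = 4 - T.card := by omega
  rw [← hker, ← Module.card_eq_pow_finrank (K := F) (V := LinearMap.ker f), ← Finset.card_univ]
  symm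
  refine Finset.card_nbij (fun x => (x : D).1) (fun x _ => ?_) (fun x _ y _ h => ?_) fun d hd => ?_
  · simp only [Finset.coe_filter, Finset.mem_univ, true_and, Set.mem_ofPred_eq]
    exact ⟨(x : D).2, restrict_eq_zero_iff.1 x.2⟩
  · exact Subtype.ext (Subtype.ext h)
  · simp only [Finset.coe_filter, Finset.mem_univ, true_and, Set.mem_ofPred_eq] at hd
    exact ⟨⟨⟨d, hd.1⟩, restrict_eq_zero_iff.2 hd.2⟩, by simp, rfl⟩

open Classical in
/-- The binomial moments of the numbers of zeros of the words of the code. -/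
lemma sum_choose_card_zeros [Fintype F] (hD : IsSteinerCode D r) {t : ℕ} (ht : t ≤ 3) :
    ∑ d : Fin n → F with d ∈ D, (zeros d).card.choose t =
      n.choose t * Fintype.card F ^ (4 - t) := by
  have h := Finset.sum_card_bipartiteAbove_eq_sum_card_bipartiteBelow
    (s := Finset.univ.filter fun d : Fin n → F => d ∈ D)
    (t := Finset.powersetCard t (Finset.univ : Finset (Fin n))) (fun d T => T ⊆ zeros d)
  have h1 (d : Fin n → F) : ((Finset.powersetCard t (Finset.univ : Finset (Fin n))).bipartiteAbove
      (fun d T => T ⊆ zeros d) d).card = (zeros d).card.choose t := by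
    rw [← Finset.card_powersetCard]
    congr 1
    ext T
    simp [Finset.bipartiteAbove, Finset.mem_powersetCard, and_comm]
  have h2 (T : Finset (Fin n)) (hT : T ∈ Finset.powersetCard t (Finset.univ : Finset (Fin n))) :
      ((Finset.univ.filter fun d : Fin n → F => d ∈ D).bipartiteBelow
        (fun d T => T ⊆ zeros d) T).card = Fintype.card F ^ (4 - t) := by
    rw [Finset.mem_powersetCard] at hT
    rw [Finset.bipartiteBelow, Finset.filter_filter, hD.card_filter_subset_zeros (by omega), hT.2]
  rw [Finset.sum_congr rfl fun d _ => h1 d, Finset.sum_congr rfl h2] at h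
  rw [h, Finset.sum_const, Finset.card_powersetCard, Finset.card_univ, Fintype.card_fin,
    smul_eq_mul]

open Classical in
/-- The number of nonzero words of the code with exactly `z` zeros. -/
noncomputable def zeroCount [Fintype F] (D : Submodule F (Fin n → F)) (z : ℕ) : ℕ :=
  (Finset.univ.filter fun d : Fin n → F => (d ∈ D ∧ d ≠ 0) ∧ (zeros d).card = z).card

open Classical in
/-- A sum over the words of the code, arranged by the number of zeros. -/
lemma sum_card_zeros [Fintype F] (hD : IsSteinerCode D r) {M : Type*} [AddCommMonoid M]
    (f : ℕ → M) :
    ∑ d : Fin n → F with d ∈ D, f (zeros d).card =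
      f n + (zeroCount D (r + 1) • f (r + 1) + (zeroCount D 2 • f 2 + (zeroCount D 1 • f 1 +
        zeroCount D 0 • f 0))) := by
  have h3 := hD.three_le
  have hsplit : (Finset.univ.filter fun d : Fin n → F => d ∈ D) =
      insert 0 (Finset.univ.filter fun d : Fin n → F => d ∈ D ∧ d ≠ 0) := by
    ext d
    by_cases hd : d = 0 <;> simp [hd]
  have hz0 : zeros (0 : Fin n → F) = Finset.univ := by
    ext; simp [mem_zeros]
  rw [hsplit, Finset.sum_insert (by simp), hz0, Finset.card_univ, Fintype.card_fin,
    -- A nonzero word has fewer than three zeros or exactly `r + 1`; the four values are distinct as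
    -- `r ≥ 3`.
    ← Finset.sum_fiberwise_of_maps_to (t := {r + 1, 2, 1, 0}) (g := fun d => (zeros d).card)]
  · rw [Finset.sum_insert (by simp; omega), Finset.sum_insert (by simp),
      Finset.sum_insert (by simp), Finset.sum_singleton]
    have hf (z : ℕ) : ∑ d ∈ (Finset.univ.filter fun d : Fin n → F => d ∈ D ∧ d ≠ 0) with
        (zeros d).card = z, f (zeros d).card = zeroCount D z • f z := by
      rw [Finset.sum_congr rfl (g := fun _ => f z) fun d hd => by rw [(Finset.mem_filter.1 hd).2],
        Finset.sum_const, Finset.filter_filter, zeroCount]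
    simp only [hf]
  · intro d hd
    simp only [Finset.mem_filter, Finset.mem_univ, true_and] at hd
    have := hD.card_zeros hd.1 hd.2
    simp only [Finset.mem_insert, Finset.mem_singleton]
    omega

lemma moment [Fintype F] (hD : IsSteinerCode D r) {t : ℕ} (ht : t ≤ 3) :
    (n.choose t : ℚ) + (zeroCount D (r + 1) * (r + 1).choose t + (zeroCount D 2 * Nat.choose 2 t +
        (zeroCount D 1 * Nat.choose 1 t + zeroCount D 0 * Nat.choose 0 t))) =
      n.choose t * (Fintype.card F : ℚ) ^ (4 - t) := by
  have h := hD.sum_choose_card_zeros ht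
  rw [hD.sum_card_zeros fun z => z.choose t] at h
  simp only [smul_eq_mul] at h
  exact_mod_cast h

lemma cast_choose_three (k : ℕ) : ((k + 1).choose 3 : ℚ) = (k + 1) * k * (k - 1) / 6 := by
  induction k with
  | zero => simp [Nat.choose]
  | succ k ih =>
    rw [Nat.choose_succ_succ', Nat.cast_add, Nat.cast_choose_two, ih]
    push_cast
    ring

/-- The weight enumerator of the code. -/
lemma weightEnumerator_eq [Fintype F] (hD : IsSteinerCode D r) {q : ℕ} (hq : Fintype.card F = q)
    (hn : n = q + 1) :
    weightEnumerator D =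
      1 + C (((q : ℚ) - 1) ^ 2 * q * (q + 1) / (((r : ℚ) ^ 2 - 1) * r)) * X ^ (q - r)
        + C (((q : ℚ) ^ 2 - 1) * q * ((q + 1) * ((r : ℚ) - 1) - (q - 1)) / (2 * ((r : ℚ) - 1))) *
            X ^ (q - 1)
        + C (((q : ℚ) ^ 2 - 1) * ((q : ℚ) ^ 2 - q + r) / r) * X ^ q
        + C ((r : ℚ) * ((q : ℚ) - 1) ^ 2 * q * (q + 1) / (2 * ((r : ℚ) + 1))) * X ^ (q + 1) := by
  classical
  subst hn
  have h3 := hD.three_le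
  have hr : (3 : ℚ) ≤ r := by exact_mod_cast h3
  have hr0 : (r : ℚ) ≠ 0 := by linarith
  have hr1 : (r : ℚ) - 1 ≠ 0 := by linarith
  have hr2 : (r : ℚ) + 1 ≠ 0 := by linarith
  have m0 := hD.moment (t := 0) (by norm_num)
  have m1 := hD.moment (t := 1) (by norm_num)
  have m2 := hD.moment (t := 2) (by norm_num)
  have m3 := hD.moment (t := 3) (by norm_num)
  rw [hq] at m0 m1 m2 m3
  rw [cast_choose_three, cast_choose_three] at m3
  rw [Nat.cast_choose_two, Nat.cast_choose_two] at m2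
  norm_num [Nat.choose] at m0 m1 m2 m3
  have hfac : (r : ℚ) ^ 2 - 1 = (r + 1) * (r - 1) := by ring
  -- The system is triangular: `z.choose 3` vanishes for `z ≤ 2`, so the third moment gives this
  -- count alone, and the lower moments give the others in turn.
  have e3 : (zeroCount D (r + 1) : ℚ) =
      ((q : ℚ) - 1) ^ 2 * q * (q + 1) / (((r : ℚ) ^ 2 - 1) * r) := by
    rw [hfac]
    field_simp
    linear_combination 6 * m3
  have e2 : (zeroCount D 2 : ℚ) =
      ((q : ℚ) ^ 2 - 1) * q * ((q + 1) * ((r : ℚ) - 1) - (q - 1)) / (2 * ((r : ℚ) - 1)) := by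
    have h : (zeroCount D 2 : ℚ) =
        (q + 1) * q / 2 * (q ^ 2 - 1) - zeroCount D (r + 1) * ((r + 1) * r / 2) := by
      linear_combination m2
    rw [h, e3, hfac]
    field_simp
    ring
  have e1 : (zeroCount D 1 : ℚ) = ((q : ℚ) ^ 2 - 1) * ((q : ℚ) ^ 2 - q + r) / r := by
    have h : (zeroCount D 1 : ℚ) =
        (q + 1) * (q ^ 3 - 1) - zeroCount D (r + 1) * (r + 1) - 2 * zeroCount D 2 := by
      linear_combination m1
    rw [h, e3, e2, hfac]
    field_simp
    ring
  have e0 : (zeroCount D 0 : ℚ) =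
      (r : ℚ) * ((q : ℚ) - 1) ^ 2 * q * (q + 1) / (2 * ((r : ℚ) + 1)) := by
    have h : (zeroCount D 0 : ℚ) =
        q ^ 4 - 1 - zeroCount D (r + 1) - zeroCount D 2 - zeroCount D 1 := by
      linear_combination m0
    rw [h, e3, e2, e1, hfac]
    field_simp
    ring
  have hwt (d : Fin (q + 1) → F) : wt d = q + 1 - (zeros d).card := by
    have := wt_add_card_zeros d
    omega
  rw [← e0, ← e1, ← e2, ← e3, weightEnumerator_eq_sum]
  simp only [hwt]
  rw [hD.sum_card_zeros fun z => (X : ℚ[X]) ^ (q + 1 - z)]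
  simp [nsmul_eq_mul, add_assoc]

end IsSteinerCode

/-! ### Frobenius fixed points and biaffine polynomials -/

section FiniteFields

variable {L : Type*} [Field L]

lemma pow_eq_self_iff {x : L} (hx : x ≠ 0) {k : ℕ} (hk : 0 < k) : x ^ k = x ↔ x ^ (k - 1) = 1 := by
  obtain ⟨k, rfl⟩ := Nat.exists_eq_add_of_lt hk
  simp only [zero_add, Nat.add_sub_cancel]
  rw [pow_succ, mul_eq_right₀ hx]

/-- The fixed points of two powers of the Frobenius map. -/
lemma pow_pow_eq_self_and_iff {p : ℕ} (hp : 0 < p) (i j : ℕ) (x : L) :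
    x ^ p ^ i = x ∧ x ^ p ^ j = x ↔ x ^ p ^ Nat.gcd i j = x := by
  by_cases hx : x = 0
  · simp [hx, hp.ne']
  · lift x to Lˣ using isUnit_iff_ne_zero.2 hx
    simp only [pow_eq_self_iff hx (pow_pos hp _)]
    simp only [← Units.val_pow_eq_pow_val, Units.val_eq_one]
    rw [← Nat.pow_sub_one_gcd_pow_sub_one, pow_gcd_eq_one]

open Classical in
/-- The number of fixed points of a power of the Frobenius map. -/
lemma card_filter_pow_pow_eq_self [Fintype L] {p N : ℕ} (hp : 0 < p)
    (hL : Fintype.card L = p ^ N) (i : ℕ) :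
    (Finset.univ.filter fun x : L => x ^ p ^ i = x).card = p ^ Nat.gcd i N := by
  have h0 : (0 : L) ∈ Finset.univ.filter fun x : L => x ^ p ^ i = x := by simp [hp.ne']
  have hker : Fintype.card (powMonoidHom (p ^ i - 1) : Lˣ →* Lˣ).ker = p ^ Nat.gcd i N - 1 := by
    rw [← Nat.card_eq_fintype_card, IsCyclic.card_powMonoidHom_ker, Nat.card_eq_fintype_card,
      Fintype.card_units, hL, Nat.pow_sub_one_gcd_pow_sub_one, Nat.gcd_comm]
  have herase : ((Finset.univ.filter fun x : L => x ^ p ^ i = x).erase 0).card =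
      Fintype.card (powMonoidHom (p ^ i - 1) : Lˣ →* Lˣ).ker := by
    rw [← Finset.card_univ]
    symm
    refine Finset.card_nbij (fun x => ((x : Lˣ) : L)) (fun x _ => ?_) (fun x _ y _ h => ?_)
      fun x hx => ?_
    · have hx : (x : Lˣ) ^ (p ^ i - 1) = 1 := x.2
      simp only [Finset.coe_erase, Finset.coe_filter, Finset.mem_univ, true_and, Set.mem_sdiff,
        Set.mem_ofPred_eq, Set.mem_singleton_iff, Units.ne_zero, not_false_eq_true, and_true]
      rw [pow_eq_self_iff (Units.ne_zero _) (pow_pos hp i)]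
      rw [← Units.val_pow_eq_pow_val, hx, Units.val_one]
    · exact Subtype.ext (Units.ext h)
    · simp only [Finset.coe_erase, Finset.coe_filter, Finset.mem_univ, true_and, Set.mem_sdiff,
        Set.mem_ofPred_eq, Set.mem_singleton_iff] at hx
      refine ⟨⟨Units.mk0 x hx.2, ?_⟩, by simp, rfl⟩
      have := (pow_eq_self_iff hx.2 (pow_pos hp i)).1 hx.1
      exact Units.ext (by simpa using this)
  rw [← Finset.card_erase_add_one h0, herase, hker]
  exact Nat.sub_add_cancel (Nat.one_le_pow _ _ hp)

/-- A nonzero polynomial of bidegree at most `(1, 1)` that vanishes at three points in general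
position vanishes exactly on the graph of a projectivity. -/
lemma biaffine_eq_zero_iff {c₁₁ c₀₁ c₁₀ c₀₀ u₁ u₂ u₃ w₁ w₂ w₃ : L}
    (hc : ¬ (c₁₁ = 0 ∧ c₀₁ = 0 ∧ c₁₀ = 0 ∧ c₀₀ = 0))
    (hu₁₂ : u₁ ≠ u₂) (hu₁₃ : u₁ ≠ u₃) (hw₁₂ : w₁ ≠ w₂) (hw₂₃ : w₂ ≠ w₃)
    (hu₂₃ : u₂ ≠ u₃) (hw₁₃ : w₁ ≠ w₃)
    (h₁ : c₁₁ * (u₁ * w₁) + c₀₁ * w₁ + c₁₀ * u₁ + c₀₀ = 0)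
    (h₂ : c₁₁ * (u₂ * w₂) + c₀₁ * w₂ + c₁₀ * u₂ + c₀₀ = 0)
    (h₃ : c₁₁ * (u₃ * w₃) + c₀₁ * w₃ + c₁₀ * u₃ + c₀₀ = 0) (v w : L) :
    c₁₁ * (v * w) + c₀₁ * w + c₁₀ * v + c₀₀ = 0 ↔
      (v - u₁) * (u₃ - u₂) * ((w - w₂) * (w₃ - w₁)) =
        (v - u₂) * (u₃ - u₁) * ((w - w₁) * (w₃ - w₂)) := by
  set b := c₁₁ * (u₁ * w₂) + c₀₁ * w₂ + c₁₀ * u₁ + c₀₀ with hb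
  set g := c₁₁ * (u₂ * w₁) + c₀₁ * w₁ + c₁₀ * u₂ + c₀₀ with hg
  have hd : (u₂ - u₁) * (w₂ - w₁) ≠ 0 :=
    mul_ne_zero (sub_ne_zero.2 hu₁₂.symm) (sub_ne_zero.2 hw₁₂.symm)
  -- Bilinear interpolation from the four corners `(u₁ or u₂, w₁ or w₂)`. Two corner values vanish
  -- by `h₁` and `h₂`; the third zero then fixes the ratio of the remaining values `b` and `g`.
  have hid (v w : L) : (u₂ - u₁) * (w₂ - w₁) * (c₁₁ * (v * w) + c₀₁ * w + c₁₀ * v + c₀₀) =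
      b * ((u₂ - v) * (w - w₁)) + g * ((v - u₁) * (w₂ - w)) := by
    rw [hb, hg]
    linear_combination (u₂ - v) * (w₂ - w) * h₁ + (v - u₁) * (w - w₁) * h₂
  have hR : (u₃ - u₁) * (w₂ - w₃) ≠ 0 :=
    mul_ne_zero (sub_ne_zero.2 hu₁₃.symm) (sub_ne_zero.2 hw₂₃)
  have hP : (u₂ - u₃) * (w₃ - w₁) ≠ 0 :=
    mul_ne_zero (sub_ne_zero.2 hu₂₃) (sub_ne_zero.2 hw₁₃.symm)
  have h3 := hid u₃ w₃
  rw [h₃, mul_zero] at h3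
  have hb0 : b ≠ 0 := by
    intro hb0
    have hg0 : g = 0 := by
      rw [hb0, zero_mul, zero_add] at h3
      exact (mul_eq_zero.1 h3.symm).resolve_right hR
    have hall (v w : L) : c₁₁ * (v * w) + c₀₁ * w + c₁₀ * v + c₀₀ = 0 := by
      have := hid v w
      rw [hb0, hg0, zero_mul, zero_mul, add_zero] at this
      exact (mul_eq_zero.1 this).resolve_left hd
    have h00 := hall 0 0
    have h10 := hall 1 0
    have h01 := hall 0 1
    have h11 := hall 1 1
    refine hc ⟨?_, ?_, ?_, ?_⟩
    · linear_combination h11 - h10 - h01 + h00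
    · linear_combination h01 - h00
    · linear_combination h10 - h00
    · linear_combination h00
  have hkey : (u₃ - u₁) * (w₂ - w₃) * ((u₂ - u₁) * (w₂ - w₁) *
      (c₁₁ * (v * w) + c₀₁ * w + c₁₀ * v + c₀₀)) =
      b * ((v - u₁) * (u₃ - u₂) * ((w₂ - w) * (w₃ - w₁)) -
        (u₂ - v) * (u₃ - u₁) * ((w - w₁) * (w₃ - w₂))) := by
    rw [hid]
    linear_combination -(v - u₁) * (w₂ - w) * h3
  rw [← mul_eq_zero_iff_left hd, ← mul_eq_zero_iff_left hR, hkey, mul_eq_zero_iff_left hb0,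
    ← sub_eq_zero (b := (v - u₂) * _ * _)]
  constructor <;> intro h <;> linear_combination -h

end FiniteFields

/-! ### Sublines of the roots of unity -/

section UnitCircle

variable {L : Type*} [Field L] [Fintype L] {p s i : ℕ} {ι : Type*} [Fintype ι]

open Classical in
/-- The size of the subline through three points of the set of `(q + 1)`-th roots of unity. -/
lemma card_subline [CharP L p] (hp : p.Prime) (hL : Fintype.card L = p ^ (2 * s))
    {u : ι → L} (hu : Function.Injective u) (hu1 : ∀ j, u j ^ (p ^ s + 1) = 1)
    (hι : Fintype.card ι = p ^ s + 1) {a b c : ι} (hab : a ≠ b) (hac : a ≠ c) (hbc : b ≠ c) :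
    (Finset.univ.filter fun j => (u j - u a) * (u c - u b) *
        ((u j ^ p ^ i - u b ^ p ^ i) * (u c ^ p ^ i - u a ^ p ^ i)) =
      (u j - u b) * (u c - u a) *
        ((u j ^ p ^ i - u a ^ p ^ i) * (u c ^ p ^ i - u b ^ p ^ i))).card = p ^ Nat.gcd i s + 1 := by
  have : Fact p.Prime := ⟨hp⟩
  have hp0 := hp.pos
  have hsub (k : ℕ) (x y : L) : x ^ p ^ k - y ^ p ^ k = (x - y) ^ p ^ k := (sub_pow_char_pow ..).symm
  have hne {j k : ι} (h : j ≠ k) : u j - u k ≠ 0 := sub_ne_zero.2 (hu.ne h)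
  have hu0 (j : ι) : u j ≠ 0 := by
    intro h
    simpa [h] using hu1 j
  -- The cross-ratio that sends `a`, `c`, `b` to `0`, `1`, `∞`. Division by zero gives a meaningless
  -- value at `b`, which is therefore removed and counted separately.
  set g : ι → L := fun j => ((u j - u a) * (u c - u b)) / ((u j - u b) * (u c - u a)) with hg
  have hginj : Set.InjOn g (Finset.univ.erase b : Finset ι) := by
    intro j hj k hk hjk
    simp only [Finset.coe_erase, Finset.coe_univ, Set.mem_sdiff, Set.mem_univ, true_and,
      Set.mem_singleton_iff] at hj hk
    have h1 := hne hj
    have h2 := hne hk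
    have h3 := hne hac.symm
    have h4 := hne hbc.symm
    simp only [hg] at hjk
    rw [div_eq_div_iff (mul_ne_zero h1 h3) (mul_ne_zero h2 h3)] at hjk
    have h5 : (u c - u b) * (u c - u a) * (u a - u b) * (u j - u k) = 0 := by
      linear_combination hjk
    have h6 := hne hab
    have h7 := (mul_eq_zero.1 h5).resolve_left (mul_ne_zero (mul_ne_zero h4 h3) h6)
    exact hu (sub_eq_zero.1 h7)
  -- The `q`-th power inverts these roots of unity, and a cross-ratio is invariant under inversion.
  have hgq (j : ι) (hj : j ≠ b) : g j ^ p ^ s = g j := by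
    have hq (j : ι) : u j ^ p ^ s = (u j)⁻¹ := by
      exact eq_inv_of_mul_eq_one_left (by rw [← pow_succ, hu1])
    have h1 := hne hj
    have h3 := hne hac.symm
    have h1' : (u j)⁻¹ - (u b)⁻¹ ≠ 0 := sub_ne_zero.2 fun h => hj (hu (inv_injective h))
    have h3' : (u c)⁻¹ - (u a)⁻¹ ≠ 0 := sub_ne_zero.2 fun h => hac.symm (hu (inv_injective h))
    simp only [hg]
    rw [div_pow, mul_pow, mul_pow, ← hsub, ← hsub, ← hsub, ← hsub, hq, hq, hq, hq,
      div_eq_div_iff (mul_ne_zero h1' h3') (mul_ne_zero h1 h3)]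
    have := hu0 j
    have := hu0 a
    have := hu0 b
    have := hu0 c
    field_simp
    ring
  -- An injection from `q` points into the `q` fixed points of the `q`-power map is onto.
  have himg : (Finset.univ.erase b).image g = Finset.univ.filter fun x : L => x ^ p ^ s = x := by
    refine Finset.eq_of_subset_of_card_le (fun x hx => ?_) ?_
    · obtain ⟨j, hj, rfl⟩ := Finset.mem_image.1 hx
      simpa using hgq j (Finset.ne_of_mem_erase hj)
    · rw [card_filter_pow_pow_eq_self hp0 hL, Finset.card_image_of_injOn hginj,
        Finset.card_erase_of_mem (Finset.mem_univ _), Finset.card_univ, hι,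
        Nat.gcd_eq_left (Dvd.intro_left 2 rfl), Nat.add_sub_cancel]
  set Z := Finset.univ.filter fun j => (u j - u a) * (u c - u b) *
        ((u j ^ p ^ i - u b ^ p ^ i) * (u c ^ p ^ i - u a ^ p ^ i)) =
      (u j - u b) * (u c - u a) *
        ((u j ^ p ^ i - u a ^ p ^ i) * (u c ^ p ^ i - u b ^ p ^ i)) with hZ
  have hbZ : b ∈ Z := by simp [hZ]
  have hZg (j : ι) (hj : j ≠ b) : j ∈ Z ↔ g j ^ p ^ i = g j := by
    have h1 := hne hj
    have h3 := hne hac.symm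
    simp only [hZ, Finset.mem_filter, Finset.mem_univ, true_and, hg, hsub]
    rw [div_pow, div_eq_div_iff (pow_ne_zero _ (mul_ne_zero h1 h3)) (mul_ne_zero h1 h3), mul_pow,
      mul_pow, eq_comm]
    constructor <;> intro h <;> linear_combination h
  have hZimg : (Z.erase b).image g =
      Finset.univ.filter fun x : L => x ^ p ^ Nat.gcd i s = x := by
    ext x
    simp only [Finset.mem_image, Finset.mem_erase, Finset.mem_filter, Finset.mem_univ, true_and]
    rw [← pow_pow_eq_self_and_iff hp0]
    constructor
    · rintro ⟨j, ⟨hj, hjZ⟩, rfl⟩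
      exact ⟨(hZg j hj).1 hjZ, hgq j hj⟩
    · rintro ⟨hx, hxq⟩
      have hx' : x ∈ (Finset.univ.erase b).image g := by rw [himg]; simpa using hxq
      obtain ⟨j, hj, rfl⟩ := Finset.mem_image.1 hx'
      have hjb := Finset.ne_of_mem_erase hj
      exact ⟨j, ⟨hjb, (hZg j hjb).2 hx⟩, rfl⟩
  rw [← Finset.card_erase_add_one hbZ, ← Finset.card_image_of_injOn (hginj.mono ?_), hZimg,
    card_filter_pow_pow_eq_self hp0 hL,
    Nat.gcd_eq_left ((Nat.gcd_dvd_right i s).trans (Dvd.intro_left 2 rfl))]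
  exact Finset.coe_subset.2 (Finset.erase_subset_erase _ (Finset.subset_univ _))

end UnitCircle

/-! ### BCH codes and trace codes -/

section BCH

variable {F L : Type*} [Field F] [Field L] [Algebra F L] {n : ℕ}

lemma aeval_wordPoly (x : L) (c : Fin n → F) :
    aeval x (wordPoly c) = ∑ j, algebraMap F L (c j) * x ^ (j : ℕ) := by
  simp [wordPoly, aeval_monomial]

/-- As `g` divides the modulus, divisibility by `g` in the quotient lifts to polynomials. -/
lemma mem_cyclicCode {g : F[X]} (hg : g ∣ X ^ n - 1) {c : Fin n → F} :
    c ∈ cyclicCode F n g ↔ g ∣ wordPoly c := by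
  have h : c ∈ cyclicCode F n g ↔ Ideal.Quotient.mk (Ideal.span {(X ^ n - 1 : F[X])}) (wordPoly c) ∈
      Ideal.span {Ideal.Quotient.mk (Ideal.span {(X ^ n - 1 : F[X])}) g} := Iff.rfl
  rw [h, Ideal.mem_span_singleton]
  constructor
  · rintro ⟨y, hy⟩
    obtain ⟨y, rfl⟩ := Ideal.Quotient.mk_surjective y
    rw [← map_mul, Ideal.Quotient.eq, Ideal.mem_span_singleton] at hy
    have h' := dvd_add (hg.trans hy) (dvd_mul_right g y)
    rwa [sub_add_cancel] at h'
  · intro h'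
    exact map_dvd _ h'

/-- The words of a BCH code of designed distance three are given by two check equations. -/
lemma mem_bchCode_three {β : L} (hβ : β ^ n = 1) {h : ℕ} {c : Fin n → F} :
    c ∈ bchCode F β n 3 h ↔
      ∑ j, algebraMap F L (c j) * (β ^ (j : ℕ)) ^ h = 0 ∧
      ∑ j, algebraMap F L (c j) * (β ^ (j : ℕ)) ^ (h + 1) = 0 := by
  classical
  have hdvd (k : ℕ) : minpoly F (β ^ k) ∣ X ^ n - 1 := by
    refine minpoly.dvd F _ ?_
    rw [map_sub, map_pow, aeval_X, map_one, ← pow_mul, mul_comm, pow_mul, hβ, one_pow, sub_self]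
  have hg : bchGenerator F β 3 h ∣ X ^ n - 1 := by
    unfold bchGenerator
    exact Finset.lcm_dvd fun j _ => hdvd _
  rw [bchCode, mem_cyclicCode hg]
  unfold bchGenerator
  rw [Finset.lcm_dvd_iff]
  have hk (k : ℕ) : minpoly F (β ^ k) ∣ wordPoly c ↔
      ∑ j, algebraMap F L (c j) * (β ^ (j : ℕ)) ^ k = 0 := by
    rw [minpoly.dvd_iff, aeval_wordPoly]
    simp only [← pow_mul, mul_comm k]
  simp only [hk]
  constructor
  · intro H
    exact ⟨H 0 (by simp), H 1 (by simp)⟩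
  · rintro ⟨h0, h1⟩ j hj
    have : j < 2 := Finset.mem_range.1 hj
    interval_cases j
    exacts [h0, h1]

/-- The words with coordinates `Tr (a * u ^ h + b * u ^ (h + 1))`, where `u = u_j`. -/
noncomputable def traceMap (F : Type*) {L : Type*} [Field F] [Field L] [Algebra F L] {n : ℕ}
    (u : Fin n → L) (h : ℕ) : (L × L) →ₗ[F] (Fin n → F) :=
  LinearMap.pi fun j => Algebra.trace F L ∘ₗ
    (LinearMap.mulRight F (u j ^ h)).coprod (LinearMap.mulRight F (u j ^ (h + 1)))

lemma traceMap_apply (u : Fin n → L) (h : ℕ) (a b : L) (j : Fin n) :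
    traceMap F u h (a, b) j = Algebra.trace F L (a * u j ^ h + b * u j ^ (h + 1)) := by
  simp [traceMap]

/-- Delsarte's theorem for the BCH codes of designed distance three. -/
lemma dual_range_traceMap [FiniteDimensional F L] [Algebra.IsSeparable F L] {β : L}
    (hβ : β ^ n = 1) (h : ℕ) :
    dual (LinearMap.range (traceMap F (fun j : Fin n => β ^ (j : ℕ)) h)) =
      bchCode F β n 3 h := by
  ext c
  have hnd (x : L) (hx : ∀ y : L, Algebra.trace F L (y * x) = 0) : x = 0 :=
    (traceForm_nondegenerate F L).2 x fun y => hx y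
  have hsum (a b : L) : ∑ j, traceMap F (fun j : Fin n => β ^ (j : ℕ)) h (a, b) j * c j =
      Algebra.trace F L (a * (∑ j, algebraMap F L (c j) * (β ^ (j : ℕ)) ^ h) +
        b * (∑ j, algebraMap F L (c j) * (β ^ (j : ℕ)) ^ (h + 1))) := by
    rw [Finset.mul_sum, Finset.mul_sum, ← Finset.sum_add_distrib, map_sum]
    refine Finset.sum_congr rfl fun j _ => ?_
    rw [traceMap_apply, mul_comm, ← smul_eq_mul, ← map_smul, Algebra.smul_def]
    congr 1
    ring
  rw [mem_bchCode_three hβ, mem_dual]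
  constructor
  · intro H
    refine ⟨hnd _ fun y => ?_, hnd _ fun y => ?_⟩
    · have := H _ ⟨(y, 0), rfl⟩
      rwa [hsum, zero_mul, add_zero] at this
    · have := H _ ⟨(0, y), rfl⟩
      rwa [hsum, zero_mul, zero_add] at this
  · rintro ⟨h0, h1⟩ _ ⟨⟨a, b⟩, rfl⟩
    rw [hsum, h0, h1, mul_zero, mul_zero, add_zero, map_zero]

end BCH

/-! ### The trace code is a Steiner code -/

section SteinerBCH

variable {F L : Type*} [Field F] [Field L] [Algebra F L] [Fintype L] {p s i h : ℕ}

/-- On the `(q + 1)`-th roots of unity, the coordinates of a trace word vanish exactly at the zeros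
of a polynomial of bidegree at most `(1, 1)` in `u` and `u ^ Q`. -/
lemma exists_biaffine [CharP L p] (hp : p.Prime) (hF : Nat.card F = p ^ s)
    (hFL : Module.finrank F L = 2) (his : i < s)
    (hh : 2 * h + p ^ i = p ^ s ∨ 2 * h + 1 = p ^ i) {a b : L} (hab : ¬ (a = 0 ∧ b = 0)) :
    ∃ c₁₁ c₀₁ c₁₀ c₀₀ : L, ¬ (c₁₁ = 0 ∧ c₀₁ = 0 ∧ c₁₀ = 0 ∧ c₀₀ = 0) ∧
      ∀ u : L, u ^ (p ^ s + 1) = 1 →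
        (Algebra.trace F L (a * u ^ h + b * u ^ (h + 1)) = 0 ↔
          c₁₁ * (u * u ^ p ^ i) + c₀₁ * u ^ p ^ i + c₁₀ * u + c₀₀ = 0) := by
  have : Fact p.Prime := ⟨hp⟩
  have hQq : p ^ i < p ^ s := Nat.pow_lt_pow_right hp.one_lt his
  set q := p ^ s with hq
  set Q := p ^ i with hQ
  -- The extension has degree two, so the trace of `x` is `x + x ^ q`.
  have htr (u : L) : algebraMap F L (Algebra.trace F L (a * u ^ h + b * u ^ (h + 1))) =
      a * u ^ h + b * u ^ (h + 1) + (a ^ q * u ^ (q * h) + b ^ q * u ^ (q * (h + 1))) := by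
    rw [FiniteField.algebraMap_trace_eq_sum_pow, hFL, hF, Finset.sum_range_succ,
      Finset.sum_range_one, pow_zero, pow_one, pow_one, hq, add_pow_char_pow, mul_pow, mul_pow,
      ← pow_mul, ← pow_mul, mul_comm h, mul_comm (h + 1)]
  have h0 (u : L) : Algebra.trace F L (a * u ^ h + b * u ^ (h + 1)) = 0 ↔
      a * u ^ h + b * u ^ (h + 1) + (a ^ q * u ^ (q * h) + b ^ q * u ^ (q * (h + 1))) = 0 := by
    rw [← htr, FaithfulSMul.algebraMap_eq_zero_iff]
  have hu0 {u : L} (hu : u ^ (q + 1) = 1) : u ≠ 0 := by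
    rintro rfl
    simp at hu
  have hq0 : q ≠ 0 := by omega
  rcases hh with hh | hh
  -- Multiply by `u ^ (q * h) = u ^ (-h)`; here `u ^ (-2h) = u ^ (Q - q) = u ^ (Q + 1)`.
  · refine ⟨a ^ q, b ^ q, b, a, fun H => hab ⟨H.2.2.2, H.2.2.1⟩, fun u hu => ?_⟩
    rw [h0, ← mul_eq_zero_iff_left (pow_ne_zero (q * h) (hu0 hu))]
    obtain ⟨k, hk⟩ := Nat.exists_eq_add_of_lt hQq
    have e1 : u ^ (q * h) * u ^ h = 1 := by
      rw [← pow_add, show q * h + h = (q + 1) * h by ring, pow_mul, hu, one_pow]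
    have e2 : u ^ (q * h) * u ^ (q * h) = u * u ^ Q := by
      rw [← pow_add, show q * h + q * h = (q + 1) * k + (1 + Q) by
        have : 2 * h = k + 1 := by omega
        calc q * h + q * h = q * (2 * h) := by ring
          _ = q * k + q := by rw [this]; ring
          _ = _ := by rw [add_mul]; omega, pow_add, pow_mul, hu, one_pow, one_mul, pow_add, pow_one]
    have e3 : u * u ^ q = 1 := by rw [← pow_succ', hu]
    rw [mul_add, mul_add, mul_add, pow_succ, mul_add_one q h, pow_add]
    constructor <;> intro H
    · linear_combination H - (a + b * u) * e1 - (a ^ q + b ^ q * u ^ q) * e2 - b ^ q * u ^ Q * e3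
    · linear_combination H + (a + b * u) * e1 + (a ^ q + b ^ q * u ^ q) * e2 + b ^ q * u ^ Q * e3
  -- Multiply by `u ^ (h + 1)`; here `u ^ (2h + 1) = u ^ Q`.
  · refine ⟨b, a, a ^ q, b ^ q, fun H => hab ⟨H.2.1, H.1⟩, fun u hu => ?_⟩
    rw [h0, ← mul_eq_zero_iff_left (pow_ne_zero (h + 1) (hu0 hu))]
    have e1 : u ^ (h + 1) * u ^ h = u ^ Q := by
      rw [← pow_add, ← hh]; congr 1; ring
    have e2 : u ^ (h + 1) * u ^ (q * h) = u := by
      rw [← pow_add, show h + 1 + q * h = (q + 1) * h + 1 by ring, pow_succ, pow_mul, hu, one_pow,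
        one_mul]
    have e3 : u ^ (h + 1) * u ^ (q * (h + 1)) = 1 := by
      rw [← pow_add, show h + 1 + q * (h + 1) = (q + 1) * (h + 1) by ring, pow_mul, hu, one_pow]
    have e4 : u ^ (h + 1) * u ^ (h + 1) = u * u ^ Q := by
      rw [← e1]; ring
    rw [mul_add, mul_add, mul_add]
    constructor <;> intro H
    · linear_combination H - a * e1 - b * e4 - a ^ q * e2 - b ^ q * e3
    · linear_combination H + a * e1 + b * e4 + a ^ q * e2 + b ^ q * e3

lemma isSteinerCode_range_traceMap [Finite F] [CharP L p] (hp : p.Prime) (hF : Nat.card F = p ^ s)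
    (hFL : Module.finrank F L = 2) (his : i < s) (hi : 0 < i) (hpm : 3 ≤ p ^ Nat.gcd i s)
    (hh : 2 * h + p ^ i = p ^ s ∨ 2 * h + 1 = p ^ i) {β : L}
    (hβ : IsPrimitiveRoot β (p ^ s + 1)) :
    IsSteinerCode (LinearMap.range (traceMap F (fun j : Fin (p ^ s + 1) => β ^ (j : ℕ)) h))
      (p ^ Nat.gcd i s) := by
  classical
  have : Fact p.Prime := ⟨hp⟩
  have hgs : Nat.gcd i s < s := (Nat.le_of_dvd hi (Nat.gcd_dvd_left i s)).trans_lt his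
  have hlt : p ^ Nat.gcd i s < p ^ s := Nat.pow_lt_pow_right hp.one_lt hgs
  have hL : Fintype.card L = p ^ (2 * s) := by
    rw [← Nat.card_eq_fintype_card, Module.natCard_eq_pow_finrank (K := F), hF, hFL, ← pow_mul,
      mul_comm]
  set u : Fin (p ^ s + 1) → L := fun j => β ^ (j : ℕ) with hu
  have huinj : Function.Injective u := fun j k hjk => Fin.ext (hβ.pow_inj j.2 k.2 hjk)
  have huQ : Function.Injective fun j => u j ^ p ^ i :=
    (iterateFrobenius_inj L p i).comp huinj
  have hu1 (j : Fin (p ^ s + 1)) : u j ^ (p ^ s + 1) = 1 := by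
    rw [hu, ← pow_mul, mul_comm, pow_mul, hβ.pow_eq_one, one_pow]
  have hzeros (T : Finset (Fin (p ^ s + 1))) (hT : T.card = 3) : ∃ Z : Finset (Fin (p ^ s + 1)),
      Z.card = p ^ Nat.gcd i s + 1 ∧ ∀ x : L × L, x ≠ 0 → T ⊆ zeros (traceMap F u h x) →
        zeros (traceMap F u h x) = Z := by
    obtain ⟨a, b, c, hab, hac, hbc, rfl⟩ := Finset.card_eq_three.1 hT
    refine ⟨_, card_subline (i := i) hp hL huinj hu1 (Fintype.card_fin _) hab hac hbc, ?_⟩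
    rintro ⟨x, y⟩ hxy hsub
    obtain ⟨c₁₁, c₀₁, c₁₀, c₀₀, hc, hz⟩ := exists_biaffine (F := F) (a := x) (b := y) hp hF hFL his hh
      (by simpa using hxy)
    have hmem (j : Fin (p ^ s + 1)) : j ∈ zeros (traceMap F u h (x, y)) ↔
        c₁₁ * (u j * u j ^ p ^ i) + c₀₁ * u j ^ p ^ i + c₁₀ * u j + c₀₀ = 0 := by
      rw [mem_zeros, traceMap_apply, hz _ (hu1 j)]
    ext j
    rw [hmem, Finset.mem_filter, biaffine_eq_zero_iff hc (huinj.ne hab) (huinj.ne hac) (huQ.ne hab)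
      (huQ.ne hbc) (huinj.ne hbc) (huQ.ne hac) ((hmem a).1 (hsub (by simp)))
      ((hmem b).1 (hsub (by simp))) ((hmem c).1 (hsub (by simp)))]
    simp
  -- A nonzero pair in the kernel would vanish at all `q + 1` positions instead of `p ^ m + 1`.
  -- Injectivity gives dimension `2 + 2 = 4`.
  have hker : LinearMap.ker (traceMap F u h) = ⊥ := by
    rw [LinearMap.ker_eq_bot']
    intro x hx
    by_contra hx0
    obtain ⟨T, -, hT⟩ := Finset.exists_subset_card_eq
      (s := (Finset.univ : Finset (Fin (p ^ s + 1)))) (n := 3)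
      (by rw [Finset.card_univ, Fintype.card_fin]; omega)
    obtain ⟨Z, hZ, hZx⟩ := hzeros T hT
    have huniv : zeros (traceMap F u h x) = Finset.univ := by
      ext j; simp [mem_zeros, hx]
    have := hZx x hx0 (huniv ▸ Finset.subset_univ T)
    rw [← this, huniv, Finset.card_univ, Fintype.card_fin] at hZ
    omega
  refine ⟨?_, hpm, by omega, fun T hT => ?_⟩
  · rw [LinearMap.finrank_range_of_inj (LinearMap.ker_eq_bot.1 hker), Module.finrank_prod, hFL]
  · obtain ⟨Z, hZ, hZx⟩ := hzeros T hT
    refine ⟨Z, hZ, ?_⟩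
    rintro _ ⟨x, rfl⟩ hx0 hTx
    exact hZx x (fun h => hx0 (by rw [h, map_zero])) hTx

end SteinerBCH

end CodeDesign

/-! ### The main theorem -/

theorem mainTheorem4 (p s i m h q : ℕ) (hp : p.Prime) (hs : 1 < s) (hi : 0 < i) (his : i < s)
    (hm : Nat.gcd i s = m) (hpm : 3 ≤ p ^ m) (hq : q = p ^ s)
    (hh : h = (q - p ^ i) / 2 ∨ (Odd p ∧ h = (p ^ i - 1) / 2))
    {F : Type*} [Field F] [Fintype F] (hF : Fintype.card F = q)
    {L : Type*} [Field L] [Algebra F L] (hL : Nat.card L = q ^ 2)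
    (β : L) (hβ : IsPrimitiveRoot β (q + 1)) :
    (IsMinDist (bchCode F β (q + 1) 3 h) 4 ∧
      SupportsSimpleDesign (bchCode F β (q + 1) 3 h) 3 (q + 1) 4 (p ^ m - 2)) ∧
    (IsMinDist (dual (bchCode F β (q + 1) 3 h)) (q - p ^ m) ∧
      ∃ lam : ℕ,
        (lam : ℚ) = ((q : ℚ) - p ^ m) * (q - p ^ m - 1) * (q - p ^ m - 2) /
            (((p : ℚ) ^ (2 * m) - 1) * p ^ m) ∧
        SupportsSimpleDesign (dual (bchCode F β (q + 1) 3 h)) 3 (q + 1) (q - p ^ m) lam) ∧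
    weightEnumerator (dual (bchCode F β (q + 1) 3 h)) =
      1 + C (((q : ℚ) - 1) ^ 2 * q * (q + 1) / (((p : ℚ) ^ (2 * m) - 1) * p ^ m)) *
            X ^ (q - p ^ m)
        + C (((q : ℚ) ^ 2 - 1) * q * ((q + 1) * ((p : ℚ) ^ m - 1) - (q - 1)) /
            (2 * ((p : ℚ) ^ m - 1))) * X ^ (q - 1)
        + C (((q : ℚ) ^ 2 - 1) * ((q : ℚ) ^ 2 - q + p ^ m) / (p : ℚ) ^ m) * X ^ q
        + C ((p : ℚ) ^ m * ((q : ℚ) - 1) ^ 2 * q * (q + 1) / (2 * ((p : ℚ) ^ m + 1))) *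
            X ^ (q + 1) := by
  -- Both halvings are exact: `p ^ s` and `p ^ i` have the parity of `p`, as both exponents are
  -- positive.
  have hh' : 2 * h + p ^ i = p ^ s ∨ 2 * h + 1 = p ^ i := by
    have hlt : p ^ i < p ^ s := Nat.pow_lt_pow_right hp.one_lt his
    rcases hh with rfl | ⟨hodd, rfl⟩
    · left
      have heven : Even (p ^ s - p ^ i) := by
        rw [Nat.even_sub hlt.le, Nat.even_pow, Nat.even_pow]
        simp [hi.ne', (show s ≠ 0 by omega)]
      rw [hq, Nat.mul_div_cancel' heven.two_dvd]
      omega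
    · right
      obtain ⟨k, hk⟩ := hodd.pow (n := i)
      omega
  subst hq
  have : Fact p.Prime := ⟨hp⟩
  have hps : 0 < p ^ s := pow_pos hp.pos s
  have : Finite L := Nat.finite_of_card_ne_zero (by rw [hL]; positivity)
  have : Fintype L := Fintype.ofFinite L
  have hFn : Nat.card F = p ^ s := by rw [Nat.card_eq_fintype_card, hF]
  have : CharP F p := charP_of_card_eq_prime_pow hF
  have : CharP L p := charP_of_injective_algebraMap (FaithfulSMul.algebraMap_injective F L) p
  have hFL : Module.finrank F L = 2 := by
    have h1 := Module.natCard_eq_pow_finrank (K := F) (V := L)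
    rw [hL, hFn] at h1
    exact (Nat.pow_right_injective (hF ▸ Fintype.one_lt_card) h1).symm
  have hD := isSteinerCode_range_traceMap hp hFn hFL his hi (by rwa [hm]) hh' hβ
  rw [hm] at hD
  -- As `m` is a proper divisor of `s`, `p ^ s ≥ p ^ m * p ^ m`, and `p ^ m ≥ 3`.
  have hmlt : 2 * p ^ m < p ^ s := by
    have hms : m < s := hm ▸ (Nat.le_of_dvd hi (Nat.gcd_dvd_left i s)).trans_lt his
    have hdvd : m ∣ s := hm ▸ Nat.gcd_dvd_right i s
    obtain ⟨k, rfl⟩ := hdvd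
    have hk : 2 ≤ k := by
      by_contra hk
      interval_cases k <;> omega
    calc 2 * p ^ m < p ^ m * p ^ m := Nat.mul_lt_mul_of_pos_right (by omega) (by omega)
      _ = p ^ (m * 2) := by rw [← pow_add, mul_two]
      _ ≤ p ^ (m * k) := Nat.pow_le_pow_right hp.pos (Nat.mul_le_mul_left m hk)
  rw [← dual_range_traceMap hβ.pow_eq_one, dual_dual, mul_comm 2 m, pow_mul,
    ← Nat.cast_pow p m, ← Nat.add_sub_add_right (p ^ s) 1 (p ^ m)]
  refine ⟨⟨hD.isMinDist_dual, hD.supportsSimpleDesign_dual⟩,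
    ⟨hD.isMinDist, hD.supportsSimpleDesign rfl hmlt⟩, ?_⟩
  rw [hD.weightEnumerator_eq hF rfl, Nat.add_sub_add_right]
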